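/- **Setting.** Consider $M$ coupled linear subsystems $x_i^+ = A_{ii}x_i + B_iu_i + \sum_{j\in\mathcal N_i}A_{ij}x_j$, $x_i\in\mathbb R^{n_i}$, $u_i\in\mathbb R^{m_i}$, where $\mathcal N_i=\{j\ne i: A_{ij}\neq 0\}$, with constraints $x_i\in\mathbb X_i=\{x: c_{x_i,r}^Tx\le d_{x_i,r},\ r=1,\dots,g_i\}$ and $u_i\in\mathbb U_i=\{u: c_{u_i,r}^Tu\le d_{u_i,r},\ r=1,\dots,l_i\}$. For sets, $S\oplus T$ is the Minkowski sum and $S\ominus T=\{a: a+T\subseteq S\}$; $\mathbb W_i=\bigoplus_{j\in\mathcal N_i}A_{ij}\mathbb X_j$. Assume that every pair $(A_{ii},B_i)$ is controllable and that every $\mathbb X_i$ and $\mathbb U_i$ is compact and has the origin in its interior. **Controller design.** For every $i$ suppose that the following has been carried out successfully. 1. Points $\bar z_i^{(0,f)}\in\mathbb R^{n_i}$, $f=1,\dots,q_i$, with $\bar z_i^{(0,1)}=0$ are chosen so that $\bar{\mathbb Z}_i^0=\mathrm{conv}\{\bar z_i^{(0,f)}\}_f$ satisfies $\bar{\mathbb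 Z}^0_i\subseteq\mathbb X_i$ and $\mathbb W_i\oplus B_{\omega_i}(0)\subseteq\bar{\mathbb Z}_i^0$ for some $\omega_i>0$. 2. For some integer $k_i$ not smaller than the controllability index of $(A_{ii},B_i)$, a solution of the following linear feasibility problem is found: points $\bar z_i^{(s,f)}$ ($1\le s\le k_i$), $\bar u_i^{(s,f)}$ ($0\le s\le k_i-1$), with $\bar z_i^{(s,1)}=0$, $\bar u_i^{(s,1)}=0$, and reals $\rho_i^{(f_1,f_2)}\ge0$, $\psi_i^{(r,s)}$, $\gamma_i^{(r,s)}$, $\alpha_i\in[0,1)$ with $$\bar z_i^{(s+1,f)}=A_{ii}\bar z_i^{(s,f)}+B_i\bar u_i^{(s,f)},\qquad \bar z_i^{(k_i,f_1)}=\sum_{f_2}\rho_i^{(f_1,f_2)}\bar z_i^{(0,f_2)},\qquad \sum_{f_2}\rho_i^{(f_1,f_2)}\le\alpha_i,$$ $$c_{u_i,r}^T\bar u_i^{(s,f)}\le\psi_i^{(r,s)},\quad \sum_{s=0}^{k_i-1}\psi_i^{(r,s)}+d_{u_i,r}\alpha_i<d_{u_i,r},\qquad c_{x_i,r}^T\bar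 z_i^{(s,f)}\le\gamma_i^{(r,s)},\quad \sum_{s=0}^{k_i-1}\gamma_i^{(r,s)}+d_{x_i,r}\alpha_i<d_{x_i,r}$$ for all $f,f_1$, all $r$ and all $s=0,\dots,k_i-1$. Put $$\mathbb Z_i=(1-\alpha_i)^{-1}\bigoplus_{s=0}^{k_i-1}\mathrm{conv}\{\bar z_i^{(s,f)}\}_f,\qquad \mathbb U_{z_i}=(1-\alpha_i)^{-1}\bigoplus_{s=0}^{k_i-1}\mathrm{conv}\{\bar u_i^{(s,f)}\}_f,$$ $$\hat{\mathbb X}_i=\mathbb X_i\ominus\mathbb Z_i,\qquad \mathbb V_i=\mathbb U_i\ominus\mathbb U_{z_i}.$$ 3. A horizon $N_i\ge1$, a stage cost $\ell_i:\mathbb R^{n_i}\times\mathbb R^{m_i}\to\mathbb R_+$, a terminal cost $V_{f_i}:\mathbb R^{n_i}\to\mathbb R_+$ and a terminal set $\hat{\mathbb X}_{f_i}\subseteq\hat{\mathbb X}_i$ are chosen such that $\ell_i(0,0)=0$, $V_{f_i}(0)=0$, $0\in\hat{\mathbb X}_{f_i}$, $\ell_i(x,v)\ge\mathcal B_i(\|(x,v)\|)$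 for all $x,v$ and some $\mathcal K_\infty$ function $\mathcal B_i$, and for some auxiliary law $\kappa_i^{aux}$ and all $x\in\hat{\mathbb X}_{f_i}$, writing $x^+=A_{ii}x+B_i\kappa_i^{aux}(x)$, one has $x^+\in\hat{\mathbb X}_{f_i}$, $\kappa_i^{aux}(x)\in\mathbb V_i$ and $V_{f_i}(x^+)-V_{f_i}(x)\le-\ell_i(x,\kappa_i^{aux}(x))$. The MPC-$i$ problem at $x_i$ is to minimize $\sum_{k=0}^{N_i-1}\ell_i(\hat x(k),v(k))+V_{f_i}(\hat x(N_i))$ over $\hat x(0)$ and $v(0),\dots,v(N_i-1)$ subject to $x_i-\hat x(0)\in\mathbb Z_i$, $\hat x(k+1)=A_{ii}\hat x(k)+B_iv(k)$, $\hat x(k)\in\hat{\mathbb X}_i$ and $v(k)\in\mathbb V_i$ for $k=0,\dots,N_i-1$, and $\hat x(N_i)\in\hat{\mathbb X}_{f_i}$. Let $\mathbb X_i^N$ be the set of $x_i\in\mathbb X_i$ for which it is feasible, and $\mathbb X^N=\prod_i\mathbb X_i^N$. For $x_i\in\mathbb X_i^N$, it is assumed that the minimum is attained, and $\eta_i(x_i)$,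 $\kappa_i(x_i)$ are the values of $\hat x(0)$ and $v(0)$ at an optimizer. For $z\in\mathbb Z_i$ let $(\mu,\beta)$ be an optimizer of the linear program that minimizes $\mu\ge0$ subject to $\beta^{(s,f)}\ge0$, $\sum_f\beta^{(s,f)}=\mu$ for all $s$, and $z=(1-\alpha_i)^{-1}\sum_{s=0}^{k_i-1}\sum_f\beta^{(s,f)}\bar z_i^{(s,f)}$; put $\bar\kappa_i(z)=(1-\alpha_i)^{-1}\sum_{s=0}^{k_i-1}\sum_f\beta^{(s,f)}\bar u_i^{(s,f)}$. If optimizers are not unique, any choice is allowed, for $\bar\kappa_i$ and for $(\eta_i,\kappa_i)$. The local controllers are $u_i=\kappa_i(x_i)+\bar\kappa_i(x_i-\eta_i(x_i))$. **Theorem.** Under these hypotheses the origin is an asymptotically stable equilibrium of the collective closed-loop system; $\mathbb X^N$ is a region of attraction, that is, a positively invariant neighbourhood of the origin such that every closed-loop trajectory starting in it converges to the origin; and if $\mathbf x(0)\in\mathbb X^N$, then $x_i(t)\in\mathbb X_i$ and $u_i(t)\in\mathbb U_i$ for all $i$ and all times $t\ge0$. -/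

import Mathlib

open Filter Topology
open scoped Pointwise

noncomputable section

namespace TubeMPC

/-- The Euclidean space `ℝⁿ`. -/
abbrev Vec (n : ℕ) : Type := EuclideanSpace ℝ (Fin n)

/-- The action of a rectangular real matrix on column vectors. -/
abbrev act {n m : ℕ} (A : Matrix (Fin n) (Fin m) ℝ) : Vec m →ₗ[ℝ] Vec n :=
  Matrix.toEuclideanLin A

/-- Minkowski difference `S ⊖ T = {a : a + T ⊆ S}`. -/
def minkDiff {E : Type*} [Add E] (S T : Set E) : Set E :=
  {a | ∀ b ∈ T, a + b ∈ S}

/-- The intersection of the half-spaces `cᵣᵀ x ≤ dᵣ`. -/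
def halfSpaces {n g : ℕ} (c : Fin g → Vec n) (d : Fin g → ℝ) : Set (Vec n) :=
  {x | ∀ r, inner ℝ (c r) x ≤ d r}

/-- Functions of class `𝒦_∞` (only the values on `[0, ∞)` matter). -/
structure IsClassKInfty (b : ℝ → ℝ) : Prop where
  continuousOn : ContinuousOn b (Set.Ici 0)
  strictMonoOn : StrictMonoOn b (Set.Ici 0)
  map_zero : b 0 = 0
  tendsto_atTop : Tendsto b atTop atTop

/-! ### Controllability -/

/-- The block matrix `[B, AB, …, A^(k-1) B]`. -/
def reachMatrix {n m : ℕ} (A : Matrix (Fin n) (Fin n) ℝ) (B : Matrix (Fin n) (Fin m) ℝ)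
    (k : ℕ) : Matrix (Fin n) (Fin k × Fin m) ℝ :=
  Matrix.of fun a p => (A ^ (p.1 : ℕ) * B) a p.2

/-- Controllability of the pair `(A, B)` (Kalman rank condition). -/
def IsControllable {n m : ℕ} (A : Matrix (Fin n) (Fin n) ℝ) (B : Matrix (Fin n) (Fin m) ℝ) :
    Prop :=
  (reachMatrix A B n).rank = n

/-- The controllability index: the least `k` such that `[B, AB, …, A^(k-1) B]` has full row
rank. -/
def controllabilityIndex {n m : ℕ} (A : Matrix (Fin n) (Fin n) ℝ)
    (B : Matrix (Fin n) (Fin m) ℝ) : ℕ :=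
  sInf {k : ℕ | (reachMatrix A B k).rank = n}

/-! ### Stability of the iterates of a map -/

/-- `e` is an asymptotically stable equilibrium of `x⁺ = F x`. -/
structure IsAsymptoticallyStable {E : Type*} [NormedAddCommGroup E] (F : E → E) (e : E) :
    Prop where
  equilibrium : F e = e
  stable : ∀ ε > 0, ∃ δ > 0, ∀ x, ‖x - e‖ < δ → ∀ t : ℕ, ‖F^[t] x - e‖ < ε
  attractive : ∃ δ > 0, ∀ x, ‖x - e‖ < δ → Tendsto (fun t : ℕ => F^[t] x) atTop (𝓝 e)

/-- `S` is a region of attraction of `e` for `x⁺ = F x`: a positively invariant neighbourhood of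
`e`, all of whose points generate trajectories converging to `e`. -/
structure IsRegionOfAttraction {E : Type*} [NormedAddCommGroup E] (F : E → E) (e : E)
    (S : Set E) : Prop where
  nhds : S ∈ 𝓝 e
  invariant : Set.MapsTo F S S
  attracted : ∀ x ∈ S, Tendsto (fun t : ℕ => F^[t] x) atTop (𝓝 e)

/-! ### The plant -/

/-- A linear system made of `M` coupled subsystems
`xᵢ⁺ = Aᵢᵢ xᵢ + Bᵢ uᵢ + ∑_{j ≠ i} Aᵢⱼ xⱼ`, with the constraints `xᵢ ∈ 𝕏ᵢ`, `uᵢ ∈ 𝕌ᵢ` given by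
finitely many linear inequalities. -/
structure Plant (M : ℕ) where
  n : Fin M → ℕ
  m : Fin M → ℕ
  A : (i j : Fin M) → Matrix (Fin (n i)) (Fin (n j)) ℝ
  B : (i : Fin M) → Matrix (Fin (n i)) (Fin (m i)) ℝ
  g : Fin M → ℕ
  cX : (i : Fin M) → Fin (g i) → Vec (n i)
  dX : (i : Fin M) → Fin (g i) → ℝ
  l : Fin M → ℕ
  cU : (i : Fin M) → Fin (l i) → Vec (m i)
  dU : (i : Fin M) → Fin (l i) → ℝ

namespace Plant

variable {M : ℕ} (P : Plant M)

/-- The state constraint set `𝕏ᵢ`. -/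
def X (i : Fin M) : Set (Vec (P.n i)) := halfSpaces (P.cX i) (P.dX i)

/-- The input constraint set `𝕌ᵢ`. -/
def U (i : Fin M) : Set (Vec (P.m i)) := halfSpaces (P.cU i) (P.dU i)

open Classical in
/-- The predecessors of subsystem `i`. -/
def pred (i : Fin M) : Finset (Fin M) := Finset.univ.filter fun j => P.A i j ≠ 0 ∧ i ≠ j

/-- The disturbance set `𝕎ᵢ = ⨁_{j ∈ 𝒩ᵢ} Aᵢⱼ 𝕏ⱼ` (Minkowski sum). -/
def W (i : Fin M) : Set (Vec (P.n i)) := ∑ j ∈ P.pred i, act (P.A i j) '' P.X j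

/-- Collective states `𝐱 = (x₁, …, x_M)`, with the Euclidean norm. -/
abbrev State : Type := PiLp 2 fun i : Fin M => Vec (P.n i)

/-- Collective inputs `𝐮 = (u₁, …, u_M)`, with the Euclidean norm. -/
abbrev Input : Type := PiLp 2 fun i : Fin M => Vec (P.m i)

/-- The collective dynamics `𝐱⁺ = 𝐀 𝐱 + 𝐁 𝐮`, where `𝐀` has the blocks `Aᵢⱼ` and
`𝐁 = diag(B₁, …, B_M)`. -/
def next (x : P.State) (u : P.Input) : P.State :=
  WithLp.toLp 2 fun i => ∑ j, act (P.A i j) (x j) + act (P.B i) (u i)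

/-- Standing hypotheses on subsystem `i`: controllability of `(Aᵢᵢ, Bᵢ)`, and `𝕏ᵢ`, `𝕌ᵢ` are
compact (hence convex polytopes) with the origin in their interior. -/
structure Admissible (i : Fin M) : Prop where
  controllable : IsControllable (P.A i i) (P.B i)
  compact_X : IsCompact (P.X i)
  zero_mem_X : (0 : Vec (P.n i)) ∈ interior (P.X i)
  compact_U : IsCompact (P.U i)
  zero_mem_U : (0 : Vec (P.m i)) ∈ interior (P.U i)

end Plant

/-! ### The parametrized robust control invariant sets -/

/-- The parameters `k`, `q`, the points `z̄^(s,f)` (`s = 0, …, k`; those with `s = 0` are chosen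
by the user), and the remaining variables `ū^(s,f)`, `ρ`, `ψ`, `γ`, `α` of the linear feasibility
problem. The index `f` ranges over `q` values, the first of which is `0`. -/
structure Tube (n m g l : ℕ) where
  k : ℕ
  q : ℕ
  q_pos : 0 < q
  zbar : Fin (k + 1) → Fin q → Vec n
  ubar : Fin k → Fin q → Vec m
  rho : Fin q → Fin q → ℝ
  psi : Fin l → Fin k → ℝ
  gam : Fin g → Fin k → ℝ
  alpha : ℝ

namespace Tube

variable {n m g l : ℕ} (T : Tube n m g l)

/-- `ℤ̄^s = convh {z̄^(s,f)}`. -/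
def Zbar (s : Fin (T.k + 1)) : Set (Vec n) := convexHull ℝ (Set.range (T.zbar s))

/-- `𝕌̄_z^s = convh {ū^(s,f)}`. -/
def Ubar (s : Fin T.k) : Set (Vec m) := convexHull ℝ (Set.range (T.ubar s))

/-- `ℤ = (1 - α)⁻¹ ⨁_{s=0}^{k-1} ℤ̄^s`. -/
def Z : Set (Vec n) := (1 - T.alpha)⁻¹ • ∑ s : Fin T.k, T.Zbar s.castSucc

/-- `𝕌_z = (1 - α)⁻¹ ⨁_{s=0}^{k-1} 𝕌̄_z^s`. -/
def Uz : Set (Vec m) := (1 - T.alpha)⁻¹ • ∑ s : Fin T.k, T.Ubar s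

/-- The constraints of the linear feasibility problem `θ ∈ Θ`, together with the convention that
the first point of every family is the origin. -/
structure Feasible (A : Matrix (Fin n) (Fin n) ℝ) (B : Matrix (Fin n) (Fin m) ℝ)
    (cX : Fin g → Vec n) (dX : Fin g → ℝ) (cU : Fin l → Vec m) (dU : Fin l → ℝ) : Prop where
  zbar_first : ∀ s, T.zbar s ⟨0, T.q_pos⟩ = 0
  ubar_first : ∀ s, T.ubar s ⟨0, T.q_pos⟩ = 0
  alpha_lt_one : T.alpha < 1
  alpha_nonneg : 0 ≤ T.alpha
  final_eq : ∀ f₁, T.zbar (Fin.last T.k) f₁ = ∑ f₂, T.rho f₁ f₂ • T.zbar 0 f₂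
  rho_sum : ∀ f₁, ∑ f₂, T.rho f₁ f₂ ≤ T.alpha
  rho_nonneg : ∀ f₁ f₂, 0 ≤ T.rho f₁ f₂
  psi_sum : ∀ r, ∑ s, T.psi r s + dU r * T.alpha < dU r
  psi_bound : ∀ r s f, inner ℝ (cU r) (T.ubar s f) ≤ T.psi r s
  gam_sum : ∀ r, ∑ s, T.gam r s + dX r * T.alpha < dX r
  gam_bound : ∀ r (s : Fin T.k) f, inner ℝ (cX r) (T.zbar s.castSucc f) ≤ T.gam r s
  dynamics : ∀ (s : Fin T.k) f,
    T.zbar s.succ f = act A (T.zbar s.castSucc f) + act B (T.ubar s f)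

/-- The constraints, in the variables `μ` and `β^(s,f)`, of the linear program attached to `z`. -/
structure LPFeasible (z : Vec n) (mu : ℝ) (beta : Fin T.k → Fin T.q → ℝ) : Prop where
  beta_nonneg : ∀ s f, 0 ≤ beta s f
  beta_sum : ∀ s, ∑ f, beta s f = mu
  mu_nonneg : 0 ≤ mu
  repr : z = (1 - T.alpha)⁻¹ • ∑ s : Fin T.k, ∑ f, beta s f • T.zbar s.castSucc f

/-- `(μ, β)` is an optimizer of the linear program attached to `z`, which minimizes `μ`. -/
def LPOptimal (z : Vec n) (mu : ℝ) (beta : Fin T.k → Fin T.q → ℝ) : Prop :=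
  T.LPFeasible z mu beta ∧ ∀ mu' beta', T.LPFeasible z mu' beta' → mu ≤ mu'

/-- `κ̄` is computed from optimizers of the linear program:
`κ̄(z) = (1 - α)⁻¹ ∑_s ∑_f β^(s,f) ū^(s,f)`. Where the optimizer is not unique, any choice is
allowed. -/
def IsFeedback (kbar : Vec n → Vec m) : Prop :=
  ∀ z ∈ T.Z, ∃ mu beta, T.LPOptimal z mu beta ∧
    kbar z = (1 - T.alpha)⁻¹ • ∑ s : Fin T.k, ∑ f, beta s f • T.ubar s f

end Tube

/-! ### Model predictive control of the nominal system -/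

/-- Horizon, stage cost, terminal cost and terminal set of a local MPC problem. -/
structure MPCData (n m : ℕ) where
  N : ℕ
  N_pos : 0 < N
  ell : Vec n → Vec m → ℝ
  Vf : Vec n → ℝ
  Xf : Set (Vec n)

namespace MPCData

variable {n m : ℕ} (D : MPCData n m)

/-- The hypotheses on the stage cost, the terminal cost and the terminal set, relative to the
tightened constraint sets `Xhat` and `V`. -/
structure Axioms (A : Matrix (Fin n) (Fin n) ℝ) (B : Matrix (Fin n) (Fin m) ℝ)
    (Xhat : Set (Vec n)) (V : Set (Vec m)) : Prop where
  Vf_nonneg : ∀ x, 0 ≤ D.Vf x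
  Vf_zero : D.Vf 0 = 0
  zero_mem_Xf : (0 : Vec n) ∈ D.Xf
  ell_zero : D.ell 0 0 = 0
  ell_bound : ∃ b : ℝ → ℝ, IsClassKInfty b ∧
    ∀ (x : Vec n) (v : Vec m), b ‖WithLp.toLp 2 (x, v)‖ ≤ D.ell x v
  Xf_subset : D.Xf ⊆ Xhat
  aux : ∃ kaux : Vec n → Vec m, ∀ x ∈ D.Xf,
    act A x + act B (kaux x) ∈ D.Xf ∧ kaux x ∈ V ∧
    D.Vf (act A x + act B (kaux x)) - D.Vf x ≤ - D.ell x (kaux x)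

/-- The constraints of the MPC problem at the measured state `x`, for a nominal state sequence
`x̂(0), …, x̂(N)` and a nominal input sequence `v(0), …, v(N-1)`. -/
structure Feasible (A : Matrix (Fin n) (Fin n) ℝ) (B : Matrix (Fin n) (Fin m) ℝ)
    (Z Xhat : Set (Vec n)) (V : Set (Vec m)) (x : Vec n)
    (xh : Fin (D.N + 1) → Vec n) (v : Fin D.N → Vec m) : Prop where
  tube : x - xh 0 ∈ Z
  dynamics : ∀ k : Fin D.N, xh k.succ = act A (xh k.castSucc) + act B (v k)
  state : ∀ k : Fin D.N, xh k.castSucc ∈ Xhat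
  input : ∀ k : Fin D.N, v k ∈ V
  terminal : xh (Fin.last D.N) ∈ D.Xf

/-- The cost `∑_{k=0}^{N-1} ℓ(x̂(k), v(k)) + V_f(x̂(N))`. -/
def cost (xh : Fin (D.N + 1) → Vec n) (v : Fin D.N → Vec m) : ℝ :=
  ∑ k : Fin D.N, D.ell (xh k.castSucc) (v k) + D.Vf (xh (Fin.last D.N))

/-- Optimal solutions of the MPC problem at the measured state `x`. -/
def Optimal (A : Matrix (Fin n) (Fin n) ℝ) (B : Matrix (Fin n) (Fin m) ℝ)
    (Z Xhat : Set (Vec n)) (V : Set (Vec m)) (x : Vec n)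
    (xh : Fin (D.N + 1) → Vec n) (v : Fin D.N → Vec m) : Prop :=
  D.Feasible A B Z Xhat V x xh v ∧
    ∀ xh' v', D.Feasible A B Z Xhat V x xh' v' → D.cost xh v ≤ D.cost xh' v'

end MPCData

/-! ### Local controllers -/

/-- The data of a local controller `u = κ(x) + κ̄(x - η(x))`. -/
structure Controller (n m g l : ℕ) where
  tube : Tube n m g l
  mpc : MPCData n m
  kbar : Vec n → Vec m
  kappa : Vec n → Vec m
  eta : Vec n → Vec n

section ClosedLoop

variable {M : ℕ} (P : Plant M)

/-- One local controller for every subsystem. -/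
abbrev Controllers : Type := (i : Fin M) → Controller (P.n i) (P.m i) (P.g i) (P.l i)

variable (C : Controllers P)

/-- The tightened state constraints `𝕏̂ᵢ = 𝕏ᵢ ⊖ ℤᵢ`. -/
def Xhat (i : Fin M) : Set (Vec (P.n i)) := minkDiff (P.X i) (C i).tube.Z

/-- The tightened input constraints `𝕍ᵢ = 𝕌ᵢ ⊖ 𝕌_{zᵢ}`. -/
def V (i : Fin M) : Set (Vec (P.m i)) := minkDiff (P.U i) (C i).tube.Uz

/-- The feasibility region `𝕏ᵢᴺ` of the `i`-th MPC problem. -/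
def feasRegion (i : Fin M) : Set (Vec (P.n i)) :=
  {x ∈ P.X i | ∃ xh v,
    (C i).mpc.Feasible (P.A i i) (P.B i) (C i).tube.Z (Xhat P C i) (V P C i) x xh v}

/-- The collective feasibility region `𝕏ᴺ = ∏ᵢ 𝕏ᵢᴺ`. -/
def collectiveRegion : Set P.State := {x | ∀ i, x i ∈ feasRegion P C i}

/-- The `i`-th local controller is an output of the design algorithm:
the set `ℤ̄ᵢ⁰ ⊆ 𝕏ᵢ` contains `𝕎ᵢ ⊕ B_ω(0)` for some `ω > 0`, the linear feasibility problem is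
solved with some `kᵢ` not smaller than the controllability index, the MPC ingredients satisfy the
axioms for the tightened constraints, `κ̄ᵢ` comes from the linear program, and on the feasibility
region `ηᵢ(x)`, `κᵢ(x)` are the optimal values of `x̂ᵢ(0)`, `vᵢ(0)` in the MPC problem. -/
structure Designed (i : Fin M) : Prop where
  index_le : controllabilityIndex (P.A i i) (P.B i) ≤ (C i).tube.k
  margin : ∃ ω > 0, P.W i + Metric.ball 0 ω ⊆ (C i).tube.Zbar 0
  Zbar_subset : (C i).tube.Zbar 0 ⊆ P.X i
  feasible : (C i).tube.Feasible (P.A i i) (P.B i) (P.cX i) (P.dX i) (P.cU i) (P.dU i)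
  mpc_axioms : (C i).mpc.Axioms (P.A i i) (P.B i) (Xhat P C i) (V P C i)
  feedback : (C i).tube.IsFeedback (C i).kbar
  optimal : ∀ x ∈ feasRegion P C i, ∃ xh v,
    (C i).mpc.Optimal (P.A i i) (P.B i) (C i).tube.Z (Xhat P C i) (V P C i) x xh v ∧
    (C i).eta x = xh 0 ∧ (C i).kappa x = v ⟨0, (C i).mpc.N_pos⟩

/-- The collective control law `uᵢ = κᵢ(xᵢ) + κ̄ᵢ(xᵢ - ηᵢ(xᵢ))`. -/
def controlLaw (x : P.State) : P.Input :=
  WithLp.toLp 2 fun i => (C i).kappa (x i) + (C i).kbar (x i - (C i).eta (x i))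

/-- The collective closed-loop map `𝐱⁺ = 𝐀 𝐱 + 𝐁 𝐯 + 𝐁 κ̄(𝐱 - 𝐱̂)`. -/
def closedLoop (x : P.State) : P.State := P.next x (controlLaw P C x)

end ClosedLoop

end TubeMPC

end

/-! Each state splits into a nominal part `η` and an error `x - η ∈ ℤ`. The feedback `κ̄` moves the
summands of the error one slot along `ℤ̄⁰, ℤ̄¹, …`. The last slot falls back into `α ℤ̄⁰`, which
leaves room in slot `0` for `1 - α` times any disturbance in `ℤ̄⁰ ⊇ 𝕎` (`shift_mem`,
`Tube.Feasible.step_mem`). So `ℤ` is robustly invariant, and the usual shifted sequence makes the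
MPC problems recursively feasible with decreasing cost (`Designed.closedLoop_mem_feasRegion`).

Two facts upgrade invariance to convergence. The linear program minimizes the mass of the
decomposition, so on `c • ℤ` the feedback acts on a decomposition of mass `c`
(`Tube.Feasible.exists_step`). The facet inequalities are strict, so `ℤ ⊆ σ 𝕏` for one `σ < 1`, and
states in `c • ℤ` produce couplings only in `cσ 𝕎`. As the zero plan has zero cost on `ℤ`, the MPC
part vanishes there, and the closed loop maps `∏ c • ℤᵢ` into `∏ cθ • ℤᵢ` with `θ < 1`
(`exists_closedLoop_contraction`). This gives stability and geometric convergence.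

From elsewhere in the region, the total MPC cost cannot keep dropping by a fixed amount, so at some
time all stage costs are small at once, and one more step enters `∏ ℤᵢ` (`exists_iterate_mem_Z`). No
continuity of the MPC value function is needed. -/

namespace TubeMPC

/-! ### Weighted vertices, scaled convex sets and shifted Minkowski sums. -/

section ConvexSets

variable {E : Type*} [NormedAddCommGroup E] [NormedSpace ℝ E]

lemma exists_weights_of_mem_convexHull_range {q : ℕ} {v : Fin q → E} {x : E}
    (hx : x ∈ convexHull ℝ (Set.range v)) :
    ∃ w : Fin q → ℝ, (∀ f, 0 ≤ w f) ∧ ∑ f, w f = 1 ∧ ∑ f, w f • v f = x := by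
  let S : Set E := {x | ∃ w : Fin q → ℝ, (∀ f, 0 ≤ w f) ∧ ∑ f, w f = 1 ∧ ∑ f, w f • v f = x}
  have hS : Convex ℝ S := by
    rintro _ ⟨w, hw, hw1, rfl⟩ _ ⟨w', hw', hw1', rfl⟩ a b ha hb hab
    refine ⟨fun f => a * w f + b * w' f,
      fun f => add_nonneg (mul_nonneg ha (hw f)) (mul_nonneg hb (hw' f)), ?_, ?_⟩
    · rw [Finset.sum_add_distrib, ← Finset.mul_sum, ← Finset.mul_sum, hw1, hw1', mul_one, mul_one,
        hab]
    · simp only [add_smul, mul_smul, Finset.sum_add_distrib, Finset.smul_sum]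
  refine convexHull_min (t := S) ?_ hS hx
  rintro _ ⟨f, rfl⟩
  refine ⟨Pi.single f 1, fun g => ?_, by simp, ?_⟩
  · by_cases h : g = f
    · subst h; simp
    · simp [h]
  · rw [Finset.sum_eq_single f] <;> simp +contextual

/-- Normalize the weights by their mass `c`. If `c = 0` all weights vanish and any vertex serves,
which is why `q` must be positive. -/
lemma exists_mem_convexHull_of_weights {q : ℕ} (hq : 0 < q) (v : Fin q → E) {β : Fin q → ℝ}
    (hβ : ∀ f, 0 ≤ β f) {c : ℝ} (hc : ∑ f, β f = c) :
    ∃ p ∈ convexHull ℝ (Set.range v), ∑ f, β f • v f = c • p := by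
  have hc0 : 0 ≤ c := hc ▸ Finset.sum_nonneg fun f _ => hβ f
  rcases hc0.eq_or_lt with h | h
  · refine ⟨v ⟨0, hq⟩, subset_convexHull _ _ ⟨_, rfl⟩, ?_⟩
    subst h
    have := (Finset.sum_eq_zero_iff_of_nonneg fun f _ => hβ f).1 hc
    rw [zero_smul]
    exact Finset.sum_eq_zero fun f hf => by rw [this f hf, zero_smul]
  · refine ⟨∑ f, (c⁻¹ * β f) • v f, ?_, ?_⟩
    · refine (convex_convexHull ℝ _).sum_mem
        (fun f _ => mul_nonneg (inv_nonneg.2 h.le) (hβ f)) ?_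
        fun f _ => subset_convexHull _ _ ⟨f, rfl⟩
      rw [← Finset.mul_sum, hc, inv_mul_cancel₀ h.ne']
    · rw [Finset.smul_sum]
      exact Finset.sum_congr rfl fun f _ => by rw [smul_smul, mul_inv_cancel_left₀ h.ne']

lemma mem_smul_of_le {K : Set E} (hK : Convex ℝ K) (h0 : (0 : E) ∈ K) {s t : ℝ} (hs : 0 ≤ s)
    (hst : s ≤ t) {p : E} (hp : p ∈ K) : s • p ∈ t • K := by
  rcases (hs.trans hst).eq_or_lt with h | h
  · obtain rfl : s = 0 := le_antisymm (hst.trans h.ge) hs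
    exact ⟨0, h0, by simp⟩
  · refine ⟨(s / t) • p, hK.smul_mem_of_zero_mem h0 hp
      ⟨div_nonneg hs h.le, (div_le_one h).2 hst⟩, ?_⟩
    simp only [smul_smul, mul_div_cancel₀ s h.ne']

lemma smul_set_mono_of_le {K : Set E} (hK : Convex ℝ K) (h0 : (0 : E) ∈ K) {s t : ℝ} (hs : 0 ≤ s)
    (hst : s ≤ t) : s • K ⊆ t • K := by
  rintro _ ⟨p, hp, rfl⟩
  exact mem_smul_of_le hK h0 hs hst hp

lemma mem_smul_of_norm_lt {K : Set E} {ω : ℝ} (hω : Metric.ball 0 ω ⊆ K) {t : ℝ} (ht : 0 < t)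
    {x : E} (hx : ‖x‖ < t * ω) : x ∈ t • K := by
  refine ⟨t⁻¹ • x, hω ?_, by simp [smul_smul, ht.ne']⟩
  rw [mem_ball_zero_iff, norm_smul, norm_inv, Real.norm_of_nonneg ht.le, inv_mul_lt_iff₀ ht]
  exact hx

/-- Shifting the summands of `∑ₛ Kₛ` when the last set fits into a multiple of the first one. -/
lemma shift_mem {k : ℕ} (hk : 0 < k) {K : Fin (k + 1) → Set E} (hK : Convex ℝ (K 0)) {a : ℝ}
    (ha : 0 ≤ a) (ha1 : a < 1) (hlast : K (Fin.last k) ⊆ a • K 0) {p : Fin k → E}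
    (hp : ∀ s, p s ∈ K s.succ) {w : E} (hw : w ∈ K 0) :
    ∑ s, p s + (1 - a) • w ∈ ∑ s : Fin k, K s.castSucc := by
  obtain _ | k := k
  · exact absurd hk (lt_irrefl 0)
  obtain ⟨b, hb, hb'⟩ := hlast (hp (Fin.last k))
  -- Every `p s` except the last fills slot `s + 1`; the last one, equal to `a • b`, joins `(1 - a)
  -- • w` in slot `0` as a convex combination.
  rw [Fin.sum_univ_castSucc (f := p), Fin.sum_univ_succ, add_assoc,
    add_comm (Finset.sum _ _) (p (Fin.last k) + _)]
  refine Set.add_mem_add ?_ ((Set.mem_fintype_sum _ _).2 ⟨fun s => p s.castSucc, fun s => ?_, rfl⟩)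
  · rw [← hb']
    exact hK hb hw ha (sub_nonneg.2 ha1.le) (by ring)
  · have := hp s.castSucc
    rwa [Fin.succ_castSucc] at this

/-- If the vector added to the shifted sum comes from a strictly smaller multiple of `K₀` than in
`shift_mem`, the result lies in a strictly smaller multiple of `∑ₛ Kₛ`. -/
lemma shift_mem_smul {k : ℕ} (hk : 0 < k) {K : Fin (k + 1) → Set E} (hK : Convex ℝ (K 0))
    {ω : ℝ} (hω : 0 < ω) (hball : Metric.ball 0 ω ⊆ K 0) (hbd : ∀ s, Bornology.IsBounded (K s))
    {a : ℝ} (ha : 0 ≤ a) (ha1 : a < 1) (hlast : K (Fin.last k) ⊆ a • K 0)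
    {σ : ℝ} (hσ : 0 ≤ σ) (hσ1 : σ < 1) :
    ∀ᶠ θ in 𝓝[<] (1 : ℝ), ∀ p : Fin k → E, (∀ s, p s ∈ K s.succ) → ∀ w ∈ K 0,
      ∑ s, p s + (1 - a) • σ • w ∈ θ • ∑ s : Fin k, K s.castSucc := by
  obtain _ | k := k
  · exact absurd hk (lt_irrefl 0)
  choose c hc using fun s => (hbd s).exists_norm_le
  set R : ℝ := ∑ s : Fin k, c s.succ.castSucc with hR
  set τ : ℝ := a + (1 - a) * σ with hτ
  have hτ0 : 0 ≤ τ := add_nonneg ha (mul_nonneg (sub_nonneg.2 ha1.le) hσ)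
  have hτ1 : τ < 1 := by nlinarith
  -- Slot `0` uses only the fraction `τ < 1`. The sum `r` of the other slots is written as `θ r + (1
  -- - θ) r`, and the small excess `(1 - θ) r` is moved into the spare `(θ - τ) K₀`, which contains
  -- a ball of radius `(θ - τ) ω`.
  have h1 : ∀ᶠ θ in 𝓝[<] (1 : ℝ), (1 - θ) * R < (θ - τ) * ω := by
    refine nhdsWithin_le_nhds (Tendsto.eventually_lt (f := fun θ : ℝ => (1 - θ) * R)
      (g := fun θ : ℝ => (θ - τ) * ω) (Continuous.tendsto (by fun_prop) 1)
      (Continuous.tendsto (by fun_prop) 1) ?_)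
    simpa using mul_pos (sub_pos.2 hτ1) hω
  have h2 : ∀ᶠ θ in 𝓝[<] (1 : ℝ), τ < θ :=
    nhdsWithin_le_nhds (eventually_gt_nhds hτ1)
  filter_upwards [h1, h2, self_mem_nhdsWithin] with θ h1 h2 h3 p hp w hw
  have h3 : θ < 1 := h3
  have hθ0 : 0 ≤ θ := hτ0.trans h2.le
  obtain ⟨b, hb, hb'⟩ := hlast (hp (Fin.last k))
  have hmem : ∀ s : Fin k, p s.castSucc ∈ K s.succ.castSucc := fun s => by
    have := hp s.castSucc
    rwa [Fin.succ_castSucc] at this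
  set r : E := ∑ s : Fin k, p s.castSucc with hr
  have hrn : ‖r‖ ≤ R := norm_sum_le_of_le _ fun s _ => hc _ _ (hmem s)
  have h4 : (1 - θ) • r ∈ (θ - τ) • K 0 := by
    refine mem_smul_of_norm_lt hball (sub_pos.2 h2) (lt_of_le_of_lt ?_ h1)
    rw [norm_smul, Real.norm_of_nonneg (sub_nonneg.2 h3.le)]
    exact mul_le_mul_of_nonneg_left hrn (sub_nonneg.2 h3.le)
  have h5 : a • b + (1 - a) • σ • w ∈ τ • K 0 := by
    rw [hτ, hK.add_smul ha (mul_nonneg (sub_nonneg.2 ha1.le) hσ), smul_smul]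
    exact Set.add_mem_add ⟨b, hb, rfl⟩ ⟨w, hw, rfl⟩
  have h6 : a • b + (1 - a) • σ • w + (1 - θ) • r ∈ θ • K 0 := by
    have : θ = τ + (θ - τ) := by ring
    rw [this, hK.add_smul hτ0 (sub_nonneg.2 h2.le), ← this]
    exact Set.add_mem_add h5 h4
  rw [Fin.sum_univ_castSucc (f := p), Fin.sum_univ_succ, smul_add, ← hr, ← hb']
  have : r + a • b + (1 - a) • σ • w
      = (a • b + (1 - a) • σ • w + (1 - θ) • r) + θ • r := by module
  change r + a • b + (1 - a) • σ • w ∈ _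
  rw [this]
  exact Set.add_mem_add h6
    ⟨r, (Set.mem_fintype_sum _ _).2 ⟨fun s => p s.castSucc, hmem, rfl⟩, rfl⟩

end ConvexSets

/-! ### The sets `ℤ` and `𝕌_z`, and the linear program. -/

namespace Tube

variable {n m g l : ℕ} (T : Tube n m g l) {A : Matrix (Fin n) (Fin n) ℝ}
  {B : Matrix (Fin n) (Fin m) ℝ} {cX : Fin g → Vec n} {dX : Fin g → ℝ} {cU : Fin l → Vec m}
  {dU : Fin l → ℝ}

lemma convex_Zbar (s : Fin (T.k + 1)) : Convex ℝ (T.Zbar s) := convex_convexHull ℝ _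

lemma isBounded_Zbar (s : Fin (T.k + 1)) : Bornology.IsBounded (T.Zbar s) :=
  ((Set.finite_range _).isCompact_convexHull ℝ).isBounded

lemma convex_Z : Convex ℝ T.Z := (convex_sum _ fun s _ => T.convex_Zbar s.castSucc).smul _

lemma mem_Z {z : Vec n} : z ∈ T.Z ↔ ∃ p : Fin T.k → Vec n, (∀ s, p s ∈ T.Zbar s.castSucc) ∧
    z = (1 - T.alpha)⁻¹ • ∑ s, p s := by
  constructor
  · rintro ⟨_, hy, rfl⟩
    obtain ⟨p, hp, rfl⟩ := (Set.mem_fintype_sum _ _).1 hy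
    exact ⟨p, hp, rfl⟩
  · rintro ⟨p, hp, rfl⟩
    exact ⟨_, (Set.mem_fintype_sum _ _).2 ⟨p, hp, rfl⟩, rfl⟩

lemma mem_Uz {u : Vec m} : u ∈ T.Uz ↔ ∃ p : Fin T.k → Vec m, (∀ s, p s ∈ T.Ubar s) ∧
    u = (1 - T.alpha)⁻¹ • ∑ s, p s := by
  constructor
  · rintro ⟨_, hy, rfl⟩
    obtain ⟨p, hp, rfl⟩ := (Set.mem_fintype_sum _ _).1 hy
    exact ⟨p, hp, rfl⟩
  · rintro ⟨p, hp, rfl⟩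
    exact ⟨_, (Set.mem_fintype_sum _ _).2 ⟨p, hp, rfl⟩, rfl⟩

lemma exists_norm_le_Z : ∃ R, ∀ z ∈ T.Z, ‖z‖ ≤ R := by
  choose c hc using fun s => (T.isBounded_Zbar s).exists_norm_le
  refine ⟨‖(1 - T.alpha)⁻¹‖ * ∑ s : Fin T.k, c s.castSucc, fun z hz => ?_⟩
  obtain ⟨p, hp, rfl⟩ := T.mem_Z.1 hz
  rw [norm_smul]
  exact mul_le_mul_of_nonneg_left (norm_sum_le_of_le _ fun s _ => hc _ _ (hp s)) (norm_nonneg _)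

/-- Bounds the optimal `μ` at `z` by every `c ≥ 0` with `z ∈ c • ℤ`; this is how the feedback sees
the scale of the error. -/
lemma exists_lpFeasible_of_mem_smul_Z {z : Vec n} {c : ℝ} (hc : 0 ≤ c) (hz : z ∈ c • T.Z) :
    ∃ β, T.LPFeasible z c β := by
  obtain ⟨_, hy, rfl⟩ := hz
  obtain ⟨p, hp, rfl⟩ := T.mem_Z.1 hy
  choose w hw hw1 hwp using fun s => exists_weights_of_mem_convexHull_range (hp s)
  refine ⟨fun s f => c * w s f, ⟨fun s f => mul_nonneg hc (hw s f), fun s => ?_, hc, ?_⟩⟩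
  · rw [← Finset.mul_sum, hw1, mul_one]
  · simp only [mul_smul, ← Finset.smul_sum, hwp]
    rw [smul_comm]

end Tube

end TubeMPC

namespace TubeMPC

lemma inner_le_of_mem_convexHull_range {n q : ℕ} {v : Fin q → Vec n} {c : Vec n} {b : ℝ}
    (h : ∀ f, inner ℝ c (v f) ≤ b) {x : Vec n} (hx : x ∈ convexHull ℝ (Set.range v)) :
    inner ℝ c x ≤ b := by
  have hconv : Convex ℝ {x : Vec n | innerSL ℝ c x ≤ b} :=
    convex_halfSpace_le (innerSL ℝ c).isBoundedLinearMap.toIsLinearMap b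
  refine convexHull_min ?_ hconv hx
  rintro _ ⟨f, rfl⟩
  exact h f

/-! ### Invariance, contraction and constraint margins of the tube. -/

namespace Tube.Feasible

variable {n m g l : ℕ} {T : Tube n m g l} {A : Matrix (Fin n) (Fin n) ℝ}
  {B : Matrix (Fin n) (Fin m) ℝ} {cX : Fin g → Vec n} {dX : Fin g → ℝ} {cU : Fin l → Vec m}
  {dU : Fin l → ℝ}

lemma zero_mem_Zbar (hT : T.Feasible A B cX dX cU dU) (s : Fin (T.k + 1)) : 0 ∈ T.Zbar s :=
  subset_convexHull _ _ ⟨_, hT.zbar_first s⟩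

lemma zero_mem_Z (hT : T.Feasible A B cX dX cU dU) : 0 ∈ T.Z :=
  T.mem_Z.2 ⟨0, fun s => hT.zero_mem_Zbar _, by simp⟩

lemma Zbar_last_subset (hT : T.Feasible A B cX dX cU dU) :
    T.Zbar (Fin.last T.k) ⊆ T.alpha • T.Zbar 0 := by
  refine convexHull_min ?_ ((T.convex_Zbar 0).smul _)
  rintro _ ⟨f, rfl⟩
  obtain ⟨p, hp, h⟩ := exists_mem_convexHull_of_weights T.q_pos (T.zbar 0) (hT.rho_nonneg f) rfl
  rw [hT.final_eq f, h]
  exact mem_smul_of_le (T.convex_Zbar 0) (hT.zero_mem_Zbar 0)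
    (Finset.sum_nonneg fun _ _ => hT.rho_nonneg _ _) (hT.rho_sum f) hp

/-- The tube controller maps a point of `c • ℤ` along the vertex dynamics. -/
lemma exists_step (hT : T.Feasible A B cX dX cU dU) {kbar : Vec n → Vec m}
    (hk : T.IsFeedback kbar) {c : ℝ} (hc : 0 ≤ c) (hc1 : c ≤ 1) {z : Vec n} (hz : z ∈ c • T.Z) :
    ∃ p : Fin T.k → Vec n, ∃ u : Fin T.k → Vec m, (∀ s, p s ∈ T.Zbar s.succ) ∧
      (∀ s, u s ∈ T.Ubar s) ∧
      act A z + act B (kbar z) = c • (1 - T.alpha)⁻¹ • ∑ s, p s ∧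
      kbar z = c • (1 - T.alpha)⁻¹ • ∑ s, u s := by
  have hzZ : z ∈ T.Z := by
    have := smul_set_mono_of_le T.convex_Z hT.zero_mem_Z hc hc1 hz
    rwa [one_smul] at this
  obtain ⟨μ, β₀, ⟨hβ₀, hopt⟩, hkz⟩ := hk z hzZ
  obtain ⟨β₁, hβ₁⟩ := T.exists_lpFeasible_of_mem_smul_Z hc hz
  have hμ : μ ≤ c := hopt _ _ hβ₁
  -- The missing mass `c - μ` goes to the first vertex, which is the origin in both families: the
  -- mass becomes exactly `c`, while `z` and `kbar z` do not change.
  let β : Fin T.k → Fin T.q → ℝ := fun s f => β₀ s f + if f = ⟨0, T.q_pos⟩ then c - μ else 0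
  have hβ : ∀ s f, 0 ≤ β s f := fun s f => by
    refine add_nonneg (hβ₀.beta_nonneg s f) ?_
    split_ifs
    · linarith
    · exact le_rfl
  have hβs : ∀ s, ∑ f, β s f = c := fun s => by
    simp [β, Finset.sum_add_distrib, hβ₀.beta_sum s]
  have hβz : ∀ s, ∑ f, β s f • T.zbar s.castSucc f = ∑ f, β₀ s f • T.zbar s.castSucc f :=
    fun s => by
      simp only [β, add_smul, Finset.sum_add_distrib, ite_smul, zero_smul, Finset.sum_ite_eq',
        Finset.mem_univ, if_true, hT.zbar_first, smul_zero, add_zero]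
  have hβu : ∀ s, ∑ f, β s f • T.ubar s f = ∑ f, β₀ s f • T.ubar s f :=
    fun s => by
      simp only [β, add_smul, Finset.sum_add_distrib, ite_smul, zero_smul, Finset.sum_ite_eq',
        Finset.mem_univ, if_true, hT.ubar_first, smul_zero, add_zero]
  choose p hp hpβ using fun s : Fin T.k =>
    exists_mem_convexHull_of_weights T.q_pos (T.zbar s.succ) (hβ s) (hβs s)
  choose u hu huβ using fun s : Fin T.k =>
    exists_mem_convexHull_of_weights T.q_pos (T.ubar s) (hβ s) (hβs s)
  refine ⟨p, u, hp, hu, ?_, ?_⟩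
  · have hz' := hβ₀.repr
    simp only [← hβz] at hz'
    simp only [← hβu] at hkz
    rw [smul_comm c, Finset.smul_sum (r := c), Finset.sum_congr rfl fun s _ => (hpβ s).symm, hkz, hz']
    simp only [map_smul, map_sum, ← smul_add, ← Finset.sum_add_distrib, ← hT.dynamics]
  · rw [hkz, smul_comm c, Finset.smul_sum (r := c), Finset.sum_congr rfl fun s _ => (huβ s).symm]
    simp only [hβu]

lemma feedback_mem_Uz (hT : T.Feasible A B cX dX cU dU) {kbar : Vec n → Vec m}
    (hk : T.IsFeedback kbar) {z : Vec n} (hz : z ∈ T.Z) : kbar z ∈ T.Uz := by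
  obtain ⟨p, u, -, hu, -, h⟩ :=
    hT.exists_step hk zero_le_one le_rfl (z := z) (by rwa [one_smul])
  exact T.mem_Uz.2 ⟨u, hu, by rw [h, one_smul]⟩

/-- `ℤ` is robustly invariant against disturbances in `ℤ̄⁰`. -/
lemma step_mem (hT : T.Feasible A B cX dX cU dU) {kbar : Vec n → Vec m}
    (hk : T.IsFeedback kbar) (hk0 : 0 < T.k) {z w : Vec n} (hz : z ∈ T.Z) (hw : w ∈ T.Zbar 0) :
    act A z + act B (kbar z) + w ∈ T.Z := by
  obtain ⟨p, u, hp, -, h, -⟩ :=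
    hT.exists_step hk zero_le_one le_rfl (z := z) (by rwa [one_smul])
  refine ⟨∑ s, p s + (1 - T.alpha) • w, shift_mem hk0 (T.convex_Zbar 0) hT.alpha_nonneg
    hT.alpha_lt_one hT.Zbar_last_subset hp hw, ?_⟩
  have hα : 1 - T.alpha ≠ 0 := (sub_pos.2 hT.alpha_lt_one).ne'
  simp only [h, one_smul, smul_add, smul_smul, one_mul, inv_mul_cancel₀ hα]

/-- The tube controller contracts `ℤ` if the disturbances stay in a smaller multiple of `ℤ̄⁰`. -/
lemma step_mem_smul (hT : T.Feasible A B cX dX cU dU) {kbar : Vec n → Vec m}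
    (hk : T.IsFeedback kbar) (hk0 : 0 < T.k) {ω : ℝ} (hω : 0 < ω)
    (hball : Metric.ball 0 ω ⊆ T.Zbar 0) {σ : ℝ} (hσ : 0 ≤ σ) (hσ1 : σ < 1) :
    ∀ᶠ θ in 𝓝[<] (1 : ℝ), ∀ c, 0 ≤ c → c ≤ 1 → ∀ z ∈ c • T.Z, ∀ w ∈ T.Zbar 0,
      act A z + act B (kbar z) + (c * σ) • w ∈ (c * θ) • T.Z := by
  filter_upwards [shift_mem_smul hk0 (T.convex_Zbar 0) hω hball T.isBounded_Zbar hT.alpha_nonneg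
    hT.alpha_lt_one hT.Zbar_last_subset hσ hσ1] with θ hθ c hc hc1 z hz w hw
  obtain ⟨p, u, hp, -, h, -⟩ := hT.exists_step hk hc hc1 hz
  obtain ⟨y, hy, hyw⟩ := hθ p hp w hw
  refine ⟨(1 - T.alpha)⁻¹ • y, ⟨y, hy, rfl⟩, ?_⟩
  have hα : 1 - T.alpha ≠ 0 := (sub_pos.2 hT.alpha_lt_one).ne'
  have : w = (1 - T.alpha)⁻¹ • (1 - T.alpha) • w := by rw [smul_smul, inv_mul_cancel₀ hα, one_smul]
  rw [h]
  change θ • y = _ at hyw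
  calc (c * θ) • (1 - T.alpha)⁻¹ • y = c • (1 - T.alpha)⁻¹ • θ • y := by module
    _ = c • (1 - T.alpha)⁻¹ • (∑ s, p s) + (c * σ) • (1 - T.alpha)⁻¹ • (1 - T.alpha) • w := by
      rw [hyw]; module
    _ = _ := by rw [← this]

lemma inner_Z_le (hT : T.Feasible A B cX dX cU dU) (r : Fin g) {z : Vec n} (hz : z ∈ T.Z) :
    inner ℝ (cX r) z ≤ (1 - T.alpha)⁻¹ * ∑ s, T.gam r s := by
  obtain ⟨p, hp, rfl⟩ := T.mem_Z.1 hz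
  rw [inner_smul_right, inner_sum]
  exact mul_le_mul_of_nonneg_left (Finset.sum_le_sum fun s _ =>
    inner_le_of_mem_convexHull_range (hT.gam_bound r s) (hp s))
    (inv_nonneg.2 (sub_nonneg.2 hT.alpha_lt_one.le))

/-- Makes the zero input admissible after tightening, as the zero plan on `ℤ` requires. -/
lemma Uz_subset (hT : T.Feasible A B cX dX cU dU) : T.Uz ⊆ halfSpaces cU dU := by
  intro u hu r
  obtain ⟨p, hp, rfl⟩ := T.mem_Uz.1 hu
  rw [inner_smul_right, inner_sum, inv_mul_le_iff₀ (sub_pos.2 hT.alpha_lt_one)]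
  have h1 : ∑ s, inner ℝ (cU r) (p s) ≤ ∑ s, T.psi r s := Finset.sum_le_sum fun s _ =>
    inner_le_of_mem_convexHull_range (hT.psi_bound r s) (hp s)
  have h2 := hT.psi_sum r
  linarith

/-- A small neighbourhood of `ℤ` lies in a multiple `σ < 1` of the state constraint set. -/
lemma add_mem_smul_halfSpaces (hT : T.Feasible A B cX dX cU dU) :
    ∀ᶠ σ in 𝓝[<] (1 : ℝ), ∀ᶠ δ in 𝓝[>] (0 : ℝ), ∀ z ∈ T.Z, ∀ y : Vec n, ‖y‖ ≤ δ →
      z + y ∈ σ • halfSpaces cX dX := by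
  -- At `σ = 1` this is `gam_sum` divided by `1 - α`. Being strict over finitely many facets, it
  -- survives for `σ` slightly below `1`, and then a small `δ` depending on `σ` fits in the gap.
  have h1 : ∀ᶠ σ in 𝓝[<] (1 : ℝ), ∀ r, (1 - T.alpha)⁻¹ * ∑ s, T.gam r s < σ * dX r := by
    refine eventually_all.2 fun r => nhdsWithin_le_nhds ?_
    refine Tendsto.eventually_const_lt (v := 1 * dX r) ?_
      (Continuous.tendsto (f := fun σ : ℝ => σ * dX r) (by fun_prop) 1)
    rw [one_mul, inv_mul_lt_iff₀ (sub_pos.2 hT.alpha_lt_one)]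
    have := hT.gam_sum r
    linarith
  have h2 : ∀ᶠ σ in 𝓝[<] (1 : ℝ), 0 < σ := nhdsWithin_le_nhds (eventually_gt_nhds one_pos)
  filter_upwards [h1, h2] with σ h1 h2
  have h3 : ∀ᶠ δ in 𝓝[>] (0 : ℝ), ∀ r,
      (1 - T.alpha)⁻¹ * ∑ s, T.gam r s + ‖cX r‖ * δ < σ * dX r := by
    refine eventually_all.2 fun r => nhdsWithin_le_nhds ?_
    refine Tendsto.eventually_lt_const (v := (1 - T.alpha)⁻¹ * ∑ s, T.gam r s + ‖cX r‖ * 0) ?_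
      (Continuous.tendsto (f := fun δ : ℝ => (1 - T.alpha)⁻¹ * ∑ s, T.gam r s + ‖cX r‖ * δ)
        (by fun_prop) 0)
    simpa using h1 r
  filter_upwards [h3] with δ h3 z hz y hy
  refine ⟨σ⁻¹ • (z + y), fun r => ?_, by simp [smul_smul, h2.ne']⟩
  rw [inner_smul_right, inv_mul_le_iff₀ h2, inner_add_right]
  have h4 : inner ℝ (cX r) y ≤ ‖cX r‖ * δ :=
    (real_inner_le_norm _ _).trans (mul_le_mul_of_nonneg_left hy (norm_nonneg _))
  linarith [hT.inner_Z_le r hz, h3 r]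

lemma Z_subset (hT : T.Feasible A B cX dX cU dU) : T.Z ⊆ halfSpaces cX dX := by
  intro z hz r
  refine (hT.inner_Z_le r hz).trans ?_
  rw [inv_mul_le_iff₀ (sub_pos.2 hT.alpha_lt_one)]
  have := hT.gam_sum r
  linarith

/-- Put `(1 - α) z` in slot `0` and zeros elsewhere. The ball inside `ℤ̄⁰` thereby lies in `ℤ`. -/
lemma Zbar_zero_subset_Z (hT : T.Feasible A B cX dX cU dU) (hk0 : 0 < T.k) :
    T.Zbar 0 ⊆ T.Z := by
  intro z hz
  have hα := sub_pos.2 hT.alpha_lt_one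
  have h1 : (1 - T.alpha) • z ∈ T.Zbar 0 := (T.convex_Zbar 0).smul_mem_of_zero_mem
    (hT.zero_mem_Zbar 0) hz ⟨hα.le, by linarith [hT.alpha_nonneg]⟩
  refine T.mem_Z.2 ⟨fun s => if s = ⟨0, hk0⟩ then (1 - T.alpha) • z else 0, fun s => ?_, ?_⟩
  · dsimp only
    split_ifs with h
    · subst h
      exact h1
    · exact hT.zero_mem_Zbar _
  · simp [smul_smul, hα.ne']

end Tube.Feasible

end TubeMPC

namespace TubeMPC

lemma IsClassKInfty.nonneg {b : ℝ → ℝ} (hb : IsClassKInfty b) {s : ℝ} (hs : 0 ≤ s) : 0 ≤ b s := by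
  rw [← hb.map_zero]
  exact hb.strictMonoOn.monotoneOn Set.self_mem_Ici hs hs

/-! ### Coercivity of the stage cost and the shifted MPC plan. -/

namespace MPCData.Axioms

variable {n m : ℕ} {D : MPCData n m} {A : Matrix (Fin n) (Fin n) ℝ}
  {B : Matrix (Fin n) (Fin m) ℝ} {Z Xhat : Set (Vec n)} {V : Set (Vec m)}

lemma ell_nonneg (hD : D.Axioms A B Xhat V) (x : Vec n) (v : Vec m) : 0 ≤ D.ell x v := by
  obtain ⟨b, hb, h⟩ := hD.ell_bound
  exact (hb.nonneg (norm_nonneg _)).trans (h x v)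

lemma norm_le_of_ell_lt (hD : D.Axioms A B Xhat V) {δ : ℝ} (hδ : 0 < δ) :
    ∃ ε > 0, ∀ x v, D.ell x v < ε → ‖x‖ ≤ δ ∧ ‖v‖ ≤ δ := by
  obtain ⟨b, hb, h⟩ := hD.ell_bound
  refine ⟨b δ, ?_, fun x v hxv => ?_⟩
  · rw [← hb.map_zero]
    exact hb.strictMonoOn Set.self_mem_Ici (Set.mem_Ici.2 hδ.le) hδ
  · have h1 : ‖(WithLp.toLp 2 (x, v) : WithLp 2 (Vec n × Vec m))‖ < δ :=
      (hb.strictMonoOn.lt_iff_lt (norm_nonneg _) hδ.le).1 ((h x v).trans_lt hxv)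
    exact ⟨(WithLp.norm_fst_le _ (WithLp.toLp 2 (x, v))).trans h1.le,
      (WithLp.norm_snd_le _ (WithLp.toLp 2 (x, v))).trans h1.le⟩

lemma eq_zero_of_ell_le (hD : D.Axioms A B Xhat V) {x : Vec n} {v : Vec m}
    (h : D.ell x v ≤ 0) : x = 0 ∧ v = 0 := by
  have key : ∀ δ > 0, ‖x‖ ≤ δ ∧ ‖v‖ ≤ δ := fun δ hδ => by
    obtain ⟨ε, hε, H⟩ := hD.norm_le_of_ell_lt hδ
    exact H x v (h.trans_lt hε)
  exact ⟨norm_le_zero_iff.1 (le_of_forall_pos_le_add fun δ hδ => by simpa using (key δ hδ).1),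
    norm_le_zero_iff.1 (le_of_forall_pos_le_add fun δ hδ => by simpa using (key δ hδ).2)⟩

lemma cost_nonneg (hD : D.Axioms A B Xhat V) (xh : Fin (D.N + 1) → Vec n)
    (v : Fin D.N → Vec m) : 0 ≤ D.cost xh v :=
  add_nonneg (Finset.sum_nonneg fun _ _ => hD.ell_nonneg _ _) (hD.Vf_nonneg _)

lemma ell_le_cost (hD : D.Axioms A B Xhat V) (xh : Fin (D.N + 1) → Vec n)
    (v : Fin D.N → Vec m) : D.ell (xh 0) (v ⟨0, D.N_pos⟩) ≤ D.cost xh v := by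
  have h0 : xh 0 = xh (Fin.castSucc ⟨0, D.N_pos⟩) := rfl
  rw [h0, MPCData.cost]
  exact (Finset.single_le_sum (f := fun k : Fin D.N => D.ell (xh k.castSucc) (v k))
    (fun _ _ => hD.ell_nonneg _ _) (Finset.mem_univ ⟨0, D.N_pos⟩)).trans
    (le_add_of_nonneg_right (hD.Vf_nonneg _))

/-- The shifted sequence, prolonged by the auxiliary law, is feasible at the successor state, and
its cost is smaller by the first stage cost. -/
lemma exists_shift (hD : D.Axioms A B Xhat V) {x x' : Vec n} {xh : Fin (D.N + 1) → Vec n}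
    {v : Fin D.N → Vec m} (hf : D.Feasible A B Z Xhat V x xh v)
    (hx' : x' - (act A (xh 0) + act B (v ⟨0, D.N_pos⟩)) ∈ Z) :
    act A (xh 0) + act B (v ⟨0, D.N_pos⟩) ∈ Xhat ∧
    ∃ xh' v', D.Feasible A B Z Xhat V x' xh' v' ∧
      D.cost xh' v' ≤ D.cost xh v - D.ell (xh 0) (v ⟨0, D.N_pos⟩) := by
  obtain ⟨kaux, haux⟩ := hD.aux
  have hsub := hD.Xf_subset
  clear hD
  obtain ⟨N, hN, ell, Vf, Xf⟩ := D
  obtain ⟨h1, h2, h3, h4, h5⟩ := hf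
  obtain _ | N := N
  · exact absurd hN (lt_irrefl 0)
  simp only [cost] at *
  obtain ⟨a1, a2, a3⟩ := haux _ h5
  -- The MPC constraints bound the states only before the horizon; the final one is covered by `Xf ⊆
  -- Xhat`.
  have hst : ∀ k : Fin (N + 1), xh k.succ ∈ Xhat := fun k => by
    induction k using Fin.lastCases with
    | last => exact hsub h5
    | cast k => exact h3 k.succ
  have h20 : xh (Fin.succ 0) = act A (xh 0) + act B (v ⟨0, hN⟩) := h2 0
  refine ⟨h20 ▸ hst 0, Fin.snoc (fun k : Fin (N + 1) => xh k.succ)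
      (act A (xh (Fin.last (N + 1))) + act B (kaux (xh (Fin.last (N + 1))))),
    Fin.snoc (fun k : Fin N => v k.succ) (kaux (xh (Fin.last (N + 1)))), ⟨?_, ?_, ?_, ?_, ?_⟩, ?_⟩
  · have : (0 : Fin (N + 1 + 1)) = Fin.castSucc 0 := rfl
    rw [this, Fin.snoc_castSucc, h20]
    exact hx'
  · intro k
    induction k using Fin.lastCases with
    | last => simp
    | cast k =>
      simp only []
      rw [Fin.succ_castSucc, Fin.snoc_castSucc, Fin.snoc_castSucc, Fin.snoc_castSucc]
      exact h2 k.succ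
  · intro k
    simp only []
    rw [Fin.snoc_castSucc]
    exact hst k
  · intro k
    induction k using Fin.lastCases with
    | last => simpa using a2
    | cast k => simpa using h4 k.succ
  · simpa using a1
  -- The common stage costs cancel, and `a3` pays for the appended stage and the new terminal cost.
  · rw [Fin.sum_univ_castSucc, Fin.sum_univ_succ (f := fun k => ell (xh k.castSucc) (v k))]
    simp only [Fin.snoc_castSucc, Fin.snoc_last, Fin.succ_castSucc, Fin.succ_last]
    have : ell (xh (Fin.castSucc 0)) (v 0) = ell (xh 0) (v ⟨0, hN⟩) := rfl
    rw [this]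
    linarith

end MPCData.Axioms

/-! ### One subsystem in closed loop. -/

section ClosedLoop

variable {M : ℕ} {P : Plant M} {C : Controllers P}

lemma next_apply (x : P.State) (u : P.Input) (i : Fin M) :
    P.next x u i =
      act (P.A i i) (x i) + act (P.B i) (u i) + ∑ j ∈ P.pred i, act (P.A i j) (x j) := by
  classical
  have h : ∑ j, act (P.A i j) (x j)
      = act (P.A i i) (x i) + ∑ j ∈ P.pred i, act (P.A i j) (x j) := by
    rw [← Finset.add_sum_erase _ _ (Finset.mem_univ i)]
    congr 1
    symm
    refine Finset.sum_subset (fun j hj => ?_) fun j hj hj' => ?_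
    · simp only [Plant.pred, Finset.mem_filter] at hj
      exact Finset.mem_erase.2 ⟨hj.2.2.symm, Finset.mem_univ j⟩
    · have hA : P.A i j = 0 := by
        by_contra hA
        exact hj' (Finset.mem_filter.2 ⟨Finset.mem_univ j, hA, (Finset.ne_of_mem_erase hj).symm⟩)
      simp [act, hA]
  change ∑ j, act (P.A i j) (x j) + act (P.B i) (u i) = _
  rw [h]
  abel

/-- The coupling term lies in the multiple `c` of the disturbance set if all neighbours lie in the
multiple `c` of their constraint sets. -/
lemma exists_coupling_eq_smul {c : ℝ} {x : P.State} (hx : ∀ j, x j ∈ c • P.X j) (i : Fin M) :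
    ∃ w ∈ P.W i, ∑ j ∈ P.pred i, act (P.A i j) (x j) = c • w := by
  choose y hy hyx using hx
  refine ⟨∑ j ∈ P.pred i, act (P.A i j) (y j),
    (Set.mem_finsetSum _ _ _).2 ⟨_, fun {j} _ => ⟨y j, hy j, rfl⟩, rfl⟩, ?_⟩
  rw [Finset.smul_sum]
  refine Finset.sum_congr rfl fun j _ => ?_
  rw [← map_smul]
  exact congrArg _ (hyx j).symm

lemma coupling_mem {x : P.State} (hx : ∀ j, x j ∈ P.X j) (i : Fin M) :
    ∑ j ∈ P.pred i, act (P.A i j) (x j) ∈ P.W i := by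
  obtain ⟨w, hw, h⟩ := exists_coupling_eq_smul (c := 1) (x := x)
    (fun j => by rw [one_smul]; exact hx j) i
  rwa [h, one_smul]

lemma closedLoop_apply (x : P.State) (i : Fin M) :
    closedLoop P C x i = (act (P.A i i) ((C i).eta (x i)) + act (P.B i) ((C i).kappa (x i))) +
      (act (P.A i i) (x i - (C i).eta (x i)) + act (P.B i) ((C i).kbar (x i - (C i).eta (x i))) +
        ∑ j ∈ P.pred i, act (P.A i j) (x j)) := by
  rw [closedLoop, next_apply]
  change act (P.A i i) (x i) + act (P.B i) ((C i).kappa (x i) + (C i).kbar (x i - (C i).eta (x i)))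
    + _ = _
  rw [map_add, map_sub]
  abel

/-- For `k = 0` the reachability matrix has no columns, hence rank `0`. The shift argument needs a
slot `0`, so this isolates the one degenerate case, a trivial state space. -/
lemma Plant.Admissible.pos_of_index_le {i : Fin M} (hP : P.Admissible i) {k : ℕ}
    (hk : controllabilityIndex (P.A i i) (P.B i) ≤ k) : 0 < k ∨ P.n i = 0 := by
  rcases Nat.eq_zero_or_pos k with rfl | h
  · right
    have h1 : controllabilityIndex (P.A i i) (P.B i) ∈
        {k : ℕ | (reachMatrix (P.A i i) (P.B i) k).rank = P.n i} :=
      -- Controllability makes the set nonempty, so the infimum is attained and is not the default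
      -- value `0`.
      Nat.sInf_mem ⟨P.n i, hP.controllable⟩
    rw [Nat.le_zero.1 hk] at h1
    have h2 := (reachMatrix (P.A i i) (P.B i) 0).rank_le_card_width
    rw [Set.mem_ofPred.1 h1] at h2
    simpa using h2
  · exact Or.inl h

namespace Designed

variable {i : Fin M}

lemma pos_or_subsingleton (hC : Designed P C i) (hP : P.Admissible i) :
    0 < (C i).tube.k ∨ Subsingleton (Vec (P.n i)) := by
  refine (hP.pos_of_index_le hC.index_le).imp_right fun h => ?_
  have : IsEmpty (Fin (P.n i)) := by rw [h]; infer_instance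
  infer_instance

lemma W_subset (hC : Designed P C i) : P.W i ⊆ (C i).tube.Zbar 0 := by
  obtain ⟨ω, hω, h⟩ := hC.margin
  intro w hw
  simpa using h (Set.add_mem_add hw (Metric.mem_ball_self hω))

lemma exists_ball_subset (hP : ∀ j, P.Admissible j) (hC : Designed P C i) :
    ∃ ω > 0, Metric.ball 0 ω ⊆ (C i).tube.Zbar 0 := by
  obtain ⟨ω, hω, h⟩ := hC.margin
  refine ⟨ω, hω, fun y hy => h ?_⟩
  have h0 : (0 : Vec (P.n i)) ∈ P.W i := by
    have := coupling_mem (P := P) (x := 0) (fun j => interior_subset (hP j).zero_mem_X) i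
    simpa using this
  simpa using Set.add_mem_add h0 hy

lemma exists_ball_subset_Z (hP : ∀ j, P.Admissible j) (hC : Designed P C i) :
    ∃ r > 0, Metric.ball 0 r ⊆ (C i).tube.Z := by
  rcases hC.pos_or_subsingleton (hP i) with hk | hs
  · obtain ⟨ω, hω, h⟩ := hC.exists_ball_subset hP
    exact ⟨ω, hω, h.trans (hC.feasible.Zbar_zero_subset_Z hk)⟩
  · exact ⟨1, one_pos, fun y _ => by
      rw [Subsingleton.elim y 0]
      exact hC.feasible.zero_mem_Z⟩

lemma step_mem (hP : P.Admissible i) (hC : Designed P C i) {z w : Vec (P.n i)}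
    (hz : z ∈ (C i).tube.Z) (hw : w ∈ P.W i) :
    act (P.A i i) z + act (P.B i) ((C i).kbar z) + w ∈ (C i).tube.Z := by
  rcases hC.pos_or_subsingleton hP with hk | hs
  · exact hC.feasible.step_mem hC.feedback hk hz (hC.W_subset hw)
  · rw [Subsingleton.elim (_ + _) (0 : Vec (P.n i))]
    exact hC.feasible.zero_mem_Z

lemma step_mem_smul (hP : ∀ j, P.Admissible j) (hC : Designed P C i) {σ : ℝ} (hσ : 0 ≤ σ)
    (hσ1 : σ < 1) :
    ∀ᶠ θ in 𝓝[<] (1 : ℝ), ∀ c, 0 ≤ c → c ≤ 1 → ∀ z ∈ c • (C i).tube.Z, ∀ w ∈ P.W i,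
      act (P.A i i) z + act (P.B i) ((C i).kbar z) + (c * σ) • w ∈ (c * θ) • (C i).tube.Z := by
  rcases hC.pos_or_subsingleton (hP i) with hk | hs
  · obtain ⟨ω, hω, h⟩ := hC.exists_ball_subset hP
    filter_upwards [hC.feasible.step_mem_smul hC.feedback hk hω h hσ hσ1] with θ hθ c hc hc1 z hz
      w hw using hθ c hc hc1 z hz w (hC.W_subset hw)
  · refine Eventually.of_forall fun θ c hc hc1 z hz w hw => ?_
    rw [Subsingleton.elim (_ + _) (0 : Vec (P.n i))]
    exact ⟨0, hC.feasible.zero_mem_Z, smul_zero _⟩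

lemma Z_subset_X (hC : Designed P C i) : (C i).tube.Z ⊆ P.X i := hC.feasible.Z_subset

/-- On `ℤᵢ` the zero sequences are feasible for the MPC problem. -/
lemma feasible_zero (hC : Designed P C i) {x : Vec (P.n i)} (hx : x ∈ (C i).tube.Z) :
    (C i).mpc.Feasible (P.A i i) (P.B i) (C i).tube.Z (Xhat P C i) (V P C i) x 0 0 where
  tube := by simpa using hx
  dynamics k := by simp
  state k := hC.mpc_axioms.Xf_subset hC.mpc_axioms.zero_mem_Xf
  input k := fun u hu => by
    rw [Pi.zero_apply, zero_add]
    exact hC.feasible.Uz_subset hu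
  terminal := hC.mpc_axioms.zero_mem_Xf

lemma Z_subset_feasRegion (hC : Designed P C i) : (C i).tube.Z ⊆ feasRegion P C i :=
  fun _ hx => ⟨hC.Z_subset_X hx, _, _, hC.feasible_zero hx⟩

/-- The zero plan is feasible with cost `0`, so the optimal first stage cost is at most `0` and
coercivity applies. On `ℤ` only `κ̄` acts. -/
lemma eta_kappa_eq_zero (hC : Designed P C i) {x : Vec (P.n i)} (hx : x ∈ (C i).tube.Z) :
    (C i).eta x = 0 ∧ (C i).kappa x = 0 := by
  obtain ⟨xh, v, ⟨-, hopt⟩, h1, h2⟩ := hC.optimal x (hC.Z_subset_feasRegion hx)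
  rw [h1, h2]
  refine hC.mpc_axioms.eq_zero_of_ell_le ((hC.mpc_axioms.ell_le_cost xh v).trans
    ((hopt _ _ (hC.feasible_zero hx)).trans (le_of_eq ?_)))
  simp [MPCData.cost, hC.mpc_axioms.ell_zero, hC.mpc_axioms.Vf_zero]

lemma sub_eta_mem (hC : Designed P C i) {x : Vec (P.n i)} (hx : x ∈ feasRegion P C i) :
    x - (C i).eta x ∈ (C i).tube.Z := by
  obtain ⟨xh, v, ⟨hf, -⟩, h1, h2⟩ := hC.optimal x hx
  rw [h1]
  exact hf.tube

lemma input_mem (hC : Designed P C i) {x : Vec (P.n i)} (hx : x ∈ feasRegion P C i) :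
    (C i).kappa x + (C i).kbar (x - (C i).eta x) ∈ P.U i := by
  obtain ⟨xh, v, ⟨hf, -⟩, h1, h2⟩ := hC.optimal x hx
  rw [h2]
  exact hf.input _ _ (hC.feasible.feedback_mem_Uz hC.feedback (hC.sub_eta_mem hx))

/-- Recursive feasibility, and decrease of the MPC cost along the closed loop. -/
lemma closedLoop_mem_feasRegion (hP : P.Admissible i) (hC : Designed P C i) {x : P.State}
    (hx : x ∈ collectiveRegion P C) {xh₀ : Fin ((C i).mpc.N + 1) → Vec (P.n i)}
    {v₀ : Fin (C i).mpc.N → Vec (P.m i)}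
    (hf₀ : (C i).mpc.Feasible (P.A i i) (P.B i) (C i).tube.Z (Xhat P C i) (V P C i) (x i) xh₀ v₀) :
    closedLoop P C x i ∈ feasRegion P C i ∧ ∃ xh v,
      (C i).mpc.Feasible (P.A i i) (P.B i) (C i).tube.Z (Xhat P C i) (V P C i)
        (closedLoop P C x i) xh v ∧
      (C i).mpc.cost xh v ≤
        (C i).mpc.cost xh₀ v₀ - (C i).mpc.ell ((C i).eta (x i)) ((C i).kappa (x i)) := by
  obtain ⟨xh, v, ⟨hf, hopt⟩, h1, h2⟩ := hC.optimal (x i) (hx i)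
  have hz := hC.step_mem hP (hC.sub_eta_mem (hx i)) (coupling_mem (fun j => (hx j).1) i)
  have hz' : closedLoop P C x i - (act (P.A i i) (xh 0) +
      act (P.B i) (v ⟨0, (C i).mpc.N_pos⟩)) ∈ (C i).tube.Z := by
    rw [closedLoop_apply, ← h1, ← h2, add_sub_cancel_left]
    exact hz
  obtain ⟨hX, xh', v', hf', hc⟩ := hC.mpc_axioms.exists_shift hf hz'
  -- The successor lies in `𝕏` because its nominal part is in `𝕏 ⊖ ℤ` and its error in `ℤ`. The cost
  -- bound passes from the optimal plan to the arbitrary plan `xh₀, v₀` by optimality.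
  refine ⟨⟨?_, xh', v', hf'⟩, xh', v', hf', ?_⟩
  · have := hX _ hz'
    rwa [add_sub_cancel] at this
  · rw [h1, h2]
    exact hc.trans (sub_le_sub_right (hopt _ _ hf₀) _)

end Designed

end ClosedLoop

end TubeMPC

namespace TubeMPC

/-! ### Constants common to all subsystems, and finite-time entry into `∏ ℤᵢ`. -/

variable {M : ℕ} {P : Plant M} {C : Controllers P}

lemma exists_uniform_tightening (hC : ∀ i, Designed P C i) :
    ∃ σ : ℝ, 0 ≤ σ ∧ σ < 1 ∧ ∃ δ > 0, ∀ i, ∀ z ∈ (C i).tube.Z, ∀ y, ‖y‖ ≤ δ →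
      z + y ∈ σ • P.X i := by
  have h1 : ∀ᶠ σ in 𝓝[<] (1 : ℝ), ∀ i, ∀ᶠ δ in 𝓝[>] (0 : ℝ), ∀ z ∈ (C i).tube.Z, ∀ y, ‖y‖ ≤ δ →
      z + y ∈ σ • P.X i :=
    eventually_all.2 fun i => (hC i).feasible.add_mem_smul_halfSpaces
  have h2 : ∀ᶠ σ in 𝓝[<] (1 : ℝ), 0 < σ := nhdsWithin_le_nhds (eventually_gt_nhds one_pos)
  obtain ⟨σ, ⟨h1, h2⟩, h3⟩ := ((h1.and h2).and self_mem_nhdsWithin).exists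
  obtain ⟨δ, h4, h5⟩ := ((eventually_all.2 h1).and self_mem_nhdsWithin).exists
  exact ⟨σ, h2.le, h3, δ, h5, h4⟩

lemma exists_uniform_contraction (hP : ∀ i, P.Admissible i) (hC : ∀ i, Designed P C i) {σ : ℝ}
    (hσ : 0 ≤ σ) (hσ1 : σ < 1) :
    ∃ θ : ℝ, 0 ≤ θ ∧ θ < 1 ∧ ∀ i, ∀ c, 0 ≤ c → c ≤ 1 → ∀ z ∈ c • (C i).tube.Z, ∀ w ∈ P.W i,
      act (P.A i i) z + act (P.B i) ((C i).kbar z) + (c * σ) • w ∈ (c * θ) • (C i).tube.Z := by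
  have h1 := eventually_all.2 fun i => (hC i).step_mem_smul hP hσ hσ1
  have h2 : ∀ᶠ θ in 𝓝[<] (1 : ℝ), 0 < θ := nhdsWithin_le_nhds (eventually_gt_nhds one_pos)
  obtain ⟨θ, ⟨h1, h2⟩, h3⟩ := ((h1.and h2).and self_mem_nhdsWithin).exists
  exact ⟨θ, h2.le, h3, h1⟩

lemma exists_uniform_ball (hP : ∀ i, P.Admissible i) (hC : ∀ i, Designed P C i) :
    ∃ r > 0, ∀ i, Metric.ball 0 r ⊆ (C i).tube.Z := by
  have h : ∀ᶠ r in 𝓝[>] (0 : ℝ), ∀ i, Metric.ball 0 r ⊆ (C i).tube.Z := by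
    refine eventually_all.2 fun i => ?_
    obtain ⟨r, hr, h⟩ := (hC i).exists_ball_subset_Z hP
    filter_upwards [nhdsWithin_le_nhds (eventually_lt_nhds hr)] with s hs
    exact (Metric.ball_subset_ball hs.le).trans h
  obtain ⟨r, h1, h2⟩ := (h.and self_mem_nhdsWithin).exists
  exact ⟨r, h2, h1⟩

/-- In the product of the sets `ℤᵢ` the closed-loop map is a contraction. -/
lemma exists_closedLoop_contraction (hP : ∀ i, P.Admissible i) (hC : ∀ i, Designed P C i) :
    ∃ θ : ℝ, 0 ≤ θ ∧ θ < 1 ∧ ∀ c, 0 ≤ c → c ≤ 1 → ∀ x : P.State, (∀ i, x i ∈ c • (C i).tube.Z) →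
      ∀ i, closedLoop P C x i ∈ (c * θ) • (C i).tube.Z := by
  obtain ⟨σ, hσ, hσ1, δ, hδ, hX⟩ := exists_uniform_tightening hC
  obtain ⟨θ, hθ, hθ1, hstep⟩ := exists_uniform_contraction hP hC hσ hσ1
  refine ⟨θ, hθ, hθ1, fun c hc hc1 x hx i => ?_⟩
  have hxZ : x i ∈ (C i).tube.Z := by
    have := smul_set_mono_of_le (C i).tube.convex_Z (hC i).feasible.zero_mem_Z hc hc1 (hx i)
    rwa [one_smul] at this
  have hxX : ∀ j, x j ∈ (c * σ) • P.X j := fun j => by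
    obtain ⟨z, hz, hzx⟩ := hx j
    rw [← hzx, mul_smul]
    exact Set.smul_mem_smul_set (by simpa using hX j z hz 0 (by simpa using hδ.le))
  obtain ⟨w, hw, h⟩ := exists_coupling_eq_smul hxX i
  obtain ⟨h1, h2⟩ := (hC i).eta_kappa_eq_zero hxZ
  rw [closedLoop_apply, h1, h2, h]
  simpa using hstep i c hc hc1 (x i) (hx i) w hw

/-- Once all nominal states and inputs are small, the state enters `∏ᵢ ℤᵢ`. -/
lemma exists_closedLoop_mem_Z (hP : ∀ i, P.Admissible i) (hC : ∀ i, Designed P C i) :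
    ∃ δ > 0, ∀ x ∈ collectiveRegion P C,
      (∀ i, ‖(C i).eta (x i)‖ ≤ δ ∧ ‖(C i).kappa (x i)‖ ≤ δ) →
      ∀ i, closedLoop P C x i ∈ (C i).tube.Z := by
  obtain ⟨σ, hσ, hσ1, δ, hδ, hX⟩ := exists_uniform_tightening hC
  obtain ⟨θ, hθ, hθ1, hstep⟩ := exists_uniform_contraction hP hC hσ hσ1
  obtain ⟨r, hr, hball⟩ := exists_uniform_ball hP hC
  let a : Fin M → ℝ := fun i =>
    ‖(act (P.A i i)).toContinuousLinearMap‖ + ‖(act (P.B i)).toContinuousLinearMap‖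
  have h1 : ∀ᶠ s in 𝓝[>] (0 : ℝ), ∀ i, a i * s < (1 - θ) * r := by
    refine eventually_all.2 fun i => nhdsWithin_le_nhds ?_
    refine Tendsto.eventually_lt_const (v := a i * 0) ?_
      (Continuous.tendsto (f := fun s : ℝ => a i * s) (by fun_prop) 0)
    rw [mul_zero]
    exact mul_pos (sub_pos.2 hθ1) hr
  have h2 : ∀ᶠ s in 𝓝[>] (0 : ℝ), s < δ := nhdsWithin_le_nhds (eventually_lt_nhds hδ)
  obtain ⟨s, ⟨h1, h2⟩, hs⟩ := ((h1.and h2).and self_mem_nhdsWithin).exists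
  refine ⟨s, hs, fun x hx hsmall i => ?_⟩
  have hxX : ∀ j, x j ∈ σ • P.X j := fun j => by
    have := hX j _ ((hC j).sub_eta_mem (hx j)) _ ((hsmall j).1.trans h2.le)
    rwa [sub_add_cancel] at this
  obtain ⟨w, hw, h⟩ := exists_coupling_eq_smul hxX i
  have hz := hstep i 1 zero_le_one le_rfl (x i - (C i).eta (x i))
    (by rw [one_smul]; exact (hC i).sub_eta_mem (hx i)) w hw
  rw [one_mul, one_mul] at hz
  -- The error step lands in `θ • ℤ`; the small nominal step fits in the remaining `(1 - θ) • ℤ`,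
  -- and convexity adds the two to `ℤ`.
  have hnom : act (P.A i i) ((C i).eta (x i)) + act (P.B i) ((C i).kappa (x i)) ∈
      (1 - θ) • (C i).tube.Z := by
    refine mem_smul_of_norm_lt (hball i) (sub_pos.2 hθ1) (lt_of_le_of_lt ?_ (h1 i))
    calc _ ≤ ‖act (P.A i i) ((C i).eta (x i))‖ + ‖act (P.B i) ((C i).kappa (x i))‖ :=
          norm_add_le _ _
      _ ≤ ‖(act (P.A i i)).toContinuousLinearMap‖ * s +
          ‖(act (P.B i)).toContinuousLinearMap‖ * s :=
        add_le_add ((act (P.A i i)).toContinuousLinearMap.le_opNorm_of_le (hsmall i).1)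
          ((act (P.B i)).toContinuousLinearMap.le_opNorm_of_le (hsmall i).2)
      _ = a i * s := (add_mul _ _ _).symm
  have hmem := Set.add_mem_add hnom hz
  rw [← (C i).tube.convex_Z.add_smul (sub_nonneg.2 hθ1.le) hθ, sub_add_cancel, one_smul] at hmem
  rwa [closedLoop_apply, h]

lemma mapsTo_collectiveRegion (hP : ∀ i, P.Admissible i) (hC : ∀ i, Designed P C i) :
    Set.MapsTo (closedLoop P C) (collectiveRegion P C) (collectiveRegion P C) := by
  intro x hx i
  obtain ⟨xh, v, hf⟩ := (hx i).2
  exact ((hC i).closedLoop_mem_feasRegion (hP i) hx hf).1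

/-- Every trajectory starting in the feasibility region enters `∏ᵢ ℤᵢ` in finite time. -/
lemma exists_iterate_mem_Z (hP : ∀ i, P.Admissible i) (hC : ∀ i, Designed P C i) {x : P.State}
    (hx : x ∈ collectiveRegion P C) :
    ∃ t : ℕ, ∀ i, ((closedLoop P C)^[t] x) i ∈ (C i).tube.Z := by
  obtain ⟨δ, hδ, hZ⟩ := exists_closedLoop_mem_Z hP hC
  have hε : ∀ᶠ ε in 𝓝[>] (0 : ℝ), ∀ i, ∀ y v, (C i).mpc.ell y v < ε → ‖y‖ ≤ δ ∧ ‖v‖ ≤ δ := by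
    refine eventually_all.2 fun i => ?_
    obtain ⟨ε, hε, h⟩ := (hC i).mpc_axioms.norm_le_of_ell_lt hδ
    filter_upwards [nhdsWithin_le_nhds (eventually_lt_nhds hε)] with s hs y v hyv
    exact h y v (hyv.trans hs)
  obtain ⟨ε, hε, hε0⟩ := (hε.and self_mem_nhdsWithin).exists
  have hε0 : 0 < ε := hε0
  -- Here `c i` is a budget bounding the cost of some feasible plan. Unless all stage costs are
  -- below `ε` simultaneously, the total budget drops by at least `ε`; it cannot become negative, so
  -- this happens fewer than `N` times.
  have key : ∀ (N : ℕ) (x : P.State), x ∈ collectiveRegion P C → ∀ c : Fin M → ℝ,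
      (∀ i, ∃ xh v, (C i).mpc.Feasible (P.A i i) (P.B i) (C i).tube.Z (Xhat P C i) (V P C i)
        (x i) xh v ∧ (C i).mpc.cost xh v ≤ c i) → ∑ i, c i < N * ε →
      ∃ t : ℕ, ∀ i, ((closedLoop P C)^[t] x) i ∈ (C i).tube.Z := by
    intro N
    induction N with
    | zero =>
      intro x _ c hc hN
      refine absurd hN (not_lt.2 ?_)
      rw [Nat.cast_zero, zero_mul]
      refine Finset.sum_nonneg fun i _ => ?_
      obtain ⟨xh, v, -, h⟩ := hc i
      exact ((hC i).mpc_axioms.cost_nonneg _ _).trans h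
    | succ N ih =>
      intro x hx c hc hN
      by_cases hsmall : ∀ i, (C i).mpc.ell ((C i).eta (x i)) ((C i).kappa (x i)) < ε
      · exact ⟨1, hZ x hx fun i => hε i _ _ (hsmall i)⟩
      · push Not at hsmall
        obtain ⟨i₀, hi₀⟩ := hsmall
        let e : Fin M → ℝ := fun i => (C i).mpc.ell ((C i).eta (x i)) ((C i).kappa (x i))
        have he : ε ≤ ∑ i, e i := hi₀.trans (Finset.single_le_sum (f := e)
          (fun i _ => (hC i).mpc_axioms.ell_nonneg _ _) (Finset.mem_univ i₀))
        obtain ⟨t, ht⟩ := ih (closedLoop P C x) (mapsTo_collectiveRegion hP hC hx)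
          (fun i => c i - e i) (fun i => by
            obtain ⟨xh, v, hf, h⟩ := hc i
            obtain ⟨-, xh', v', hf', h'⟩ := (hC i).closedLoop_mem_feasRegion (hP i) hx hf
            exact ⟨xh', v', hf', h'.trans (sub_le_sub_right h _)⟩) (by
            rw [Finset.sum_sub_distrib]
            push_cast at hN
            linarith)
        exact ⟨t + 1, ht⟩
  choose xh v hf using fun i => (hx i).2
  obtain ⟨N, hN⟩ := exists_nat_gt ((∑ i, (C i).mpc.cost (xh i) (v i)) / ε)
  exact key N x hx _ (fun i => ⟨xh i, v i, hf i, le_rfl⟩) ((div_lt_iff₀ hε0).1 hN)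

lemma iterate_mem_smul_Z {θ : ℝ} (hθ : 0 ≤ θ) (hθ1 : θ ≤ 1)
    (h : ∀ c, 0 ≤ c → c ≤ 1 → ∀ x : P.State, (∀ i, x i ∈ c • (C i).tube.Z) →
      ∀ i, closedLoop P C x i ∈ (c * θ) • (C i).tube.Z)
    {c : ℝ} (hc : 0 ≤ c) (hc1 : c ≤ 1) {x : P.State} (hx : ∀ i, x i ∈ c • (C i).tube.Z) (t : ℕ) :
    ∀ i, ((closedLoop P C)^[t] x) i ∈ (c * θ ^ t) • (C i).tube.Z := by
  induction t with
  | zero => simpa using hx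
  | succ t ih =>
    intro i
    rw [Function.iterate_succ_apply', pow_succ, ← mul_assoc]
    exact h _ (mul_nonneg hc (pow_nonneg hθ t))
      (mul_le_one₀ hc1 (pow_nonneg hθ t) (pow_le_one₀ hθ hθ1)) _ ih i

lemma exists_uniform_norm_le (C : Controllers P) :
    ∃ R > 0, ∀ i, ∀ c, 0 ≤ c → ∀ z ∈ c • (C i).tube.Z, ‖z‖ ≤ c * R := by
  have h : ∀ᶠ R in atTop, ∀ i, ∀ c, 0 ≤ c → ∀ z ∈ c • (C i).tube.Z, ‖z‖ ≤ c * R := by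
    refine eventually_all.2 fun i => ?_
    obtain ⟨R, hR⟩ := (C i).tube.exists_norm_le_Z
    filter_upwards [eventually_ge_atTop R] with R' hR' c hc
    rintro _ ⟨z, hz, rfl⟩
    rw [norm_smul, Real.norm_of_nonneg hc]
    exact mul_le_mul_of_nonneg_left ((hR z hz).trans hR') hc
  obtain ⟨R, h1, h2⟩ := (h.and (eventually_gt_atTop 0)).exists
  exact ⟨R, h2, h1⟩

/-! ### Convergence and stability of the collective state. -/

lemma tendsto_state {ι : Type*} {l : Filter ι} {f : ι → P.State} {x : P.State}
    (h : ∀ i, Tendsto (fun t => f t i) l (𝓝 (x i))) : Tendsto f l (𝓝 x) :=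
  ((PiLp.continuous_toLp 2 fun i => Vec (P.n i)).tendsto x.ofLp).comp (tendsto_pi_nhds.2 h)

lemma exists_norm_lt_of_components (P : Plant M) {ε : ℝ} (hε : 0 < ε) :
    ∃ η > 0, ∀ x : P.State, (∀ i, ‖x i‖ < η) → ‖x‖ < ε := by
  -- Dividing by `M + 1` keeps the bound strict and also covers `M = 0`.
  refine ⟨ε / (M + 1), by positivity, fun x hx => ?_⟩
  have h1 : ‖x‖ ≤ ∑ i, ‖x i‖ := by
    rw [PiLp.norm_eq_of_L2]
    refine Real.sqrt_le_iff.2 ⟨Finset.sum_nonneg fun _ _ => norm_nonneg _, ?_⟩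
    exact Finset.sum_sq_le_sq_sum_of_nonneg fun _ _ => norm_nonneg _
  have h2 : ∑ i, ‖x i‖ ≤ M * (ε / (M + 1)) := by
    refine (Finset.sum_le_sum fun i _ => (hx i).le).trans (le_of_eq ?_)
    simp
  have h3 : (M : ℝ) * (ε / (M + 1)) < ε := by
    rw [mul_div_assoc', div_lt_iff₀ (by positivity)]
    linarith
  linarith

lemma tendsto_iterate_of_mem_Z (hP : ∀ i, P.Admissible i) (hC : ∀ i, Designed P C i)
    {x : P.State} (hx : ∀ i, x i ∈ (C i).tube.Z) :
    Tendsto (fun t : ℕ => (closedLoop P C)^[t] x) atTop (𝓝 0) := by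
  obtain ⟨θ, hθ, hθ1, h⟩ := exists_closedLoop_contraction hP hC
  obtain ⟨R, -, hR⟩ := exists_uniform_norm_le C
  refine tendsto_state fun i => squeeze_zero_norm (a := fun t : ℕ => θ ^ t * R) (fun t => ?_) ?_
  · have := iterate_mem_smul_Z hθ hθ1.le h zero_le_one le_rfl (x := x) (by simpa using hx) t i
    rw [one_mul] at this
    exact hR i _ (pow_nonneg hθ t) _ this
  · simpa using (tendsto_pow_atTop_nhds_zero_of_lt_one hθ hθ1).mul_const R

lemma isRegionOfAttraction_collectiveRegion (hP : ∀ i, P.Admissible i)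
    (hC : ∀ i, Designed P C i) :
    IsRegionOfAttraction (closedLoop P C) 0 (collectiveRegion P C) where
  nhds := by
    obtain ⟨r, hr, h⟩ := exists_uniform_ball hP hC
    filter_upwards [Metric.ball_mem_nhds (0 : P.State) hr] with x hx i
    refine (hC i).Z_subset_feasRegion (h i ?_)
    rw [mem_ball_zero_iff] at hx ⊢
    exact (PiLp.norm_apply_le x i).trans_lt hx
  invariant := mapsTo_collectiveRegion hP hC
  attracted := by
    intro x hx
    obtain ⟨t, ht⟩ := exists_iterate_mem_Z hP hC hx
    have := tendsto_iterate_of_mem_Z hP hC ht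
    simp only [← Function.iterate_add_apply] at this
    exact (tendsto_add_atTop_iff_nat (f := fun s : ℕ => (closedLoop P C)^[s] x) t).1 this

lemma isAsymptoticallyStable_closedLoop (hP : ∀ i, P.Admissible i)
    (hC : ∀ i, Designed P C i) : IsAsymptoticallyStable (closedLoop P C) 0 where
  equilibrium := by
    obtain ⟨θ, -, -, h⟩ := exists_closedLoop_contraction hP hC
    obtain ⟨R, -, hR⟩ := exists_uniform_norm_le C
    ext1 i
    -- The contraction at scale `c = 0` forces the image of the origin to have norm at most `0`.
    have := hR i _ (zero_mul θ).ge _ (h 0 le_rfl zero_le_one 0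
      (fun i => ⟨0, (hC i).feasible.zero_mem_Z, smul_zero _⟩) i)
    rw [zero_mul, zero_mul] at this
    exact norm_le_zero_iff.1 this
  stable := by
    intro ε hε
    obtain ⟨θ, hθ, hθ1, h⟩ := exists_closedLoop_contraction hP hC
    obtain ⟨R, hR0, hR⟩ := exists_uniform_norm_le C
    obtain ⟨r, hr, hball⟩ := exists_uniform_ball hP hC
    obtain ⟨η, hη, hnorm⟩ := exists_norm_lt_of_components P hε
    -- `c < 1` permits the contraction and `c R < η` bounds all of `c • ℤᵢ`; the ball of radius `c
    -- r` starts the trajectory inside these sets.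
    obtain ⟨c, hc0, hc⟩ := exists_between (lt_min one_pos (div_pos hη hR0))
    have hc1 := hc.trans_le (min_le_left _ _)
    have hcR : c * R < η := (lt_div_iff₀ hR0).1 (hc.trans_le (min_le_right _ _))
    refine ⟨c * r, mul_pos hc0 hr, fun x hx t => ?_⟩
    rw [sub_zero] at hx ⊢
    refine hnorm _ fun i => lt_of_le_of_lt ?_ hcR
    have hmem := iterate_mem_smul_Z hθ hθ1.le h hc0.le hc1.le (x := x) (fun j =>
      mem_smul_of_norm_lt (hball j) hc0 ((PiLp.norm_apply_le x j).trans_lt hx)) t i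
    refine (hR i _ (mul_nonneg hc0.le (pow_nonneg hθ t)) _ hmem).trans ?_
    exact mul_le_mul_of_nonneg_right
      (mul_le_of_le_one_right hc0.le (pow_le_one₀ hθ hθ1.le)) hR0.le
  attractive := by
    have h := isRegionOfAttraction_collectiveRegion hP hC
    obtain ⟨δ, hδ, hsub⟩ := Metric.mem_nhds_iff.1 h.nhds
    exact ⟨δ, hδ, fun x hx => h.attracted x (hsub (by simpa using hx))⟩

end TubeMPC

theorem theorem1 {M : ℕ} (P : TubeMPC.Plant M) (C : TubeMPC.Controllers P)
    (hP : ∀ i, P.Admissible i) (hC : ∀ i, TubeMPC.Designed P C i) :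
    TubeMPC.IsAsymptoticallyStable (TubeMPC.closedLoop P C) 0 ∧
    TubeMPC.IsRegionOfAttraction (TubeMPC.closedLoop P C) 0 (TubeMPC.collectiveRegion P C) ∧
    ∀ x₀ ∈ TubeMPC.collectiveRegion P C, ∀ t : ℕ, ∀ i : Fin M,
      ((TubeMPC.closedLoop P C)^[t] x₀) i ∈ P.X i ∧
      (TubeMPC.controlLaw P C ((TubeMPC.closedLoop P C)^[t] x₀)) i ∈ P.U i := by
  refine ⟨TubeMPC.isAsymptoticallyStable_closedLoop hP hC,
    TubeMPC.isRegionOfAttraction_collectiveRegion hP hC, fun x₀ hx₀ t i => ?_⟩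
  have h := (TubeMPC.mapsTo_collectiveRegion hP hC).iterate t hx₀ i
  exact ⟨h.1, (hC i).input_mem h⟩
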